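/- Let $\Sigma$ be an alphabet, let $m,k\ge 0$ be integers, $\varepsilon>0$ and $0<\beta<1$. Strings are indexed from $0$; $\mathrm{dist}_H$ is the Hamming distance; $Q^\infty[0,m-1]$ is the length-$m$ prefix of the infinite repetition of a nonempty string $Q$; $Q$ is primitive if $Q\ne T^r$ for all strings $T$ and all $r\ge 2$. A (randomized) algorithm $A$ takes a string $S$ of some length $n$ and a pattern $P\in\Sigma^m$ and outputs a random subset of $\{0,\dots,n-1\}$; it is $\varepsilon$-differentially private if $\Pr(A(S,P)\in \mathrm{Out})\le e^{\varepsilon}\Pr(A(S',P)\in \mathrm{Out})$ for all $P\in\Sigma^m$, all strings $S,S'$ of equal length that differ in exactly one position, and all sets $\mathrm{Out}$ of possible outputs. **Theorem.** There is an $\varepsilon$-differentially private algorithm $A$ with the following property. Let $P\in\Sigma^m$ and $n\ge m$, and suppose that there is a primitive string $Q$ over $\Sigma$ with $$|Q|\le \frac{m}{32C},\qquad C=\max\Big(k,\ \frac{96(\ln n+\ln(6/\beta))}{\varepsilon}\Big),\qquad \mathrm{dist}_H\big(P,Q^\infty[0,m-1]\big)\le 2k .$$ Then for every string $S\in\Sigma^n$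 the output $I$ of $A(S,P)$ is always a subset of $\{0,\dots,n-m\}$, and with probability at least $1-\beta$ both of the following hold for all $i\in\{0,\dots,n-m\}$: 1. if $\mathrm{dist}_H(P,S[i,i+m-1])\le k$, then $i\in I$; 2. if $i\in I$, then $\mathrm{dist}_H(P,S[i,i+m-1])\le (1+\gamma)k+\alpha$, where $\gamma=7$ and $\alpha=6\cdot\frac{96(\ln n+\ln(6/\beta))}{\varepsilon}$. -/

import Mathlib

namespace PatternMatching

variable {α : Type*}

/- A string of length `n` over the alphabet `α` is a function `Fin n → α`. -/

/-- The length-`m` substring `S[i, i+m-1]` of a string `S` of length `n`. -/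
def substr {n : ℕ} (S : Fin n → α) (m i : ℕ) (h : i + m ≤ n) : Fin m → α :=
  fun j => S ⟨i + j, by omega⟩

/-- `Q` is primitive: it is not of the form `T^r` for a string `T` and an `r ≥ 2`. -/
def IsPrimitive {q : ℕ} (Q : Fin q → α) : Prop :=
  ¬ ∃ r t : ℕ, 2 ≤ r ∧ ∃ (h : q = r * t) (T : Fin t → α), Q = Fin.repeat r T ∘ Fin.cast h

/-- A primitive string is not empty. -/
theorem IsPrimitive.pos {q : ℕ} {Q : Fin q → α} (hQ : IsPrimitive Q) : 0 < q := by
  rcases Nat.eq_zero_or_pos q with rfl | h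
  · exact absurd ⟨2, 0, le_rfl, rfl, Q, funext fun i => i.elim0⟩ hQ
  · exact h

/-- The prefix `Q^∞[0, m-1]` of length `m` of the infinite repetition of a nonempty string `Q`. -/
def repeatPrefix {q : ℕ} (Q : Fin q → α) (hq : 0 < q) (m : ℕ) : Fin m → α :=
  fun i => Q ⟨i % q, Nat.mod_lt _ hq⟩

/-- A (randomized) pattern matching algorithm, reporting variant: on a string `S` of any length `n`
and a pattern `P` of length `m` it outputs a random subset of `[0, n-1]`. It is given by the
distribution of its output on each input. -/
abbrev ReportingAlgorithm (α : Type*) (m : ℕ) :=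
  (n : ℕ) → (Fin n → α) → (Fin m → α) → PMF (Finset (Fin n))

/-- Two strings of the same length are neighbouring if they differ in exactly one position. -/
def Neighbouring [DecidableEq α] {n : ℕ} (S S' : Fin n → α) : Prop :=
  hammingDist S S' = 1

/-- `ε`-differential privacy with respect to the string (the pattern is public). -/
def IsDifferentiallyPrivate [DecidableEq α] {m : ℕ} (ε : ℝ) (A : ReportingAlgorithm α m) : Prop :=
  ∀ (P : Fin m → α) (n : ℕ) (S S' : Fin n → α), Neighbouring S S' →
    ∀ Out : Set (Finset (Fin n)),
      (A n S P).toOuterMeasure Out ≤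
        ENNReal.ofReal (Real.exp ε) * (A n S' P).toOuterMeasure Out

/-- `I` is a correct output for the reporting variant of the `k`-approximate pattern matching
problem with one-sided error, with multiplicative error `γ` and additive error `a`. -/
structure IsReport [DecidableEq α] {n m : ℕ} (S : Fin n → α) (P : Fin m → α) (k : ℕ) (γ a : ℝ)
    (I : Finset (Fin n)) : Prop where
  /-- Every reported position is a starting position in `[0, n-m]`. -/
  range : ∀ i ∈ I, (i : ℕ) + m ≤ n
  /-- Every `k`-mismatch occurrence is reported. -/
  complete : ∀ (i : Fin n) (hi : (i : ℕ) + m ≤ n),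
    hammingDist P (substr S m i hi) ≤ k → i ∈ I
  /-- Every reported position has distance at most `(1 + γ) k + a`. -/
  sound : ∀ (i : Fin n) (hi : (i : ℕ) + m ≤ n), i ∈ I →
    (hammingDist P (substr S m i hi) : ℝ) ≤ (1 + γ) * k + a

/-- The quantity `96 (ln n + ln (6/β)) / ε`. -/
noncomputable def errorTerm (n : ℕ) (ε β : ℝ) : ℝ :=
  96 * (Real.log n + Real.log (6 / β)) / ε

end PatternMatching

/-!
The algorithm runs one exponential mechanism. The starting positions are cut into blocks of length
about `m / 2`, and for each block the mechanism chooses an arithmetic progression `{l, l + q, …} ∩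
[l, r)`; the report consists of the chosen positions. With `E = 96 (ln n + ln (6 / β)) / ε`,
`T = k + 2 E` and `T' = 8 k + 4 E`, the loss of a choice on a block is the largest amount by which an
omitted window has distance below `T` or a reported window has distance above `T'`.

*Privacy.* Changing one letter of the text changes every distance by at most `1`, hence every block
loss by at most `1`. Only three blocks have a window that contains the letter, so the total loss
changes by at most `3`, and after scaling by `ε / 6` the mechanism is `ε`-differentially private
(`expMechanism_toOuterMeasure_le`, `abs_totalLoss_sub_le`).

*A lossless choice exists* (`exists_blockLoss_eq_zero`). Let `P` be at distance at most `2 k` from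
`Q^∞`, and consider the windows of a block at distance at most `T` from `P`. Two of them overlap in at
least `m / 2` letters, where `Q^∞` and its shift by the difference of the starting positions have at
most `2 (2 k + T)` mismatches. As `Q` is primitive, a shift by a non-multiple of `|Q|` has a mismatch
in every window of length `|Q|` (`IsPrimitive.div_le_prefixDist`), which is too many; so all these
windows start at positions congruent modulo `|Q|`. If `l` and `r` are the first and the last of them,
the text between `l` and `r + m` is at distance at most `2 (2 k + T)` from a repetition of `Q`, so all
`i ∈ [l, r]` with `i ≡ l` modulo `|Q|` have distance at most `2 (2 k + T) + 2 k ≤ T'`. The length bound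
on `Q` says too little only if `max k E < 1 / 6`; then `T < 1` and `k = 0`, so only exact occurrences
matter, and two of them in one block force a short period on `P`, whose primitive root takes the role
of `Q`.

*Accuracy.* Since the loss is a sum over blocks, a loss of at least `2 E` on a given block has
probability at most `(n + 1) ^ 3 * exp (-ε / 6 * 2 E)`, where `(n + 1) ^ 3` bounds the number of
progressions (`expMechanism_coordinate_le`). A union bound over the blocks leaves probability at most
`β`. If all block losses are below `2 E`, omitted windows have distance more than `T - 2 E = k`
and reported ones less than `T' + 2 E = 8 k + 6 E` (`isReport_report`).
-/

open scoped ENNReal NNReal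

namespace PatternMatching

/-! ### The exponential mechanism -/

section Mechanism

variable {Ω : Type*}

/-- The unnormalised weight `exp (-u ω)` of an outcome with loss `u ω`. -/
noncomputable def expWeight (u : Ω → ℝ) (ω : Ω) : ℝ≥0∞ :=
  ENNReal.ofReal (Real.exp (-u ω))

theorem expWeight_le {u u' : Ω → ℝ} {δ : ℝ} (h : ∀ ω, u' ω ≤ u ω + δ) (ω : Ω) :
    expWeight u ω ≤ ENNReal.ofReal (Real.exp δ) * expWeight u' ω := by
  rw [expWeight, expWeight, ← ENNReal.ofReal_mul (Real.exp_nonneg _), ← Real.exp_add]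
  exact ENNReal.ofReal_le_ofReal (Real.exp_le_exp.2 (by linarith [h ω]))

theorem tsum_expWeight_ne_zero [Nonempty Ω] (u : Ω → ℝ) : ∑' ω, expWeight u ω ≠ 0 := by
  obtain ⟨ω⟩ := ‹Nonempty Ω›
  intro h
  have := ENNReal.tsum_eq_zero.1 h ω
  simp only [expWeight, ENNReal.ofReal_eq_zero, not_le.2 (Real.exp_pos _)] at this

theorem tsum_expWeight_ne_top [Fintype Ω] (u : Ω → ℝ) : ∑' ω, expWeight u ω ≠ ∞ := by
  rw [tsum_fintype]
  exact ENNReal.sum_ne_top.2 fun _ _ => ENNReal.ofReal_ne_top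

variable [Fintype Ω] [Nonempty Ω]

/-- The exponential mechanism: the outcome `ω` has probability proportional to `exp (-u ω)`. The
scaling by the privacy parameter is part of the loss `u`. -/
noncomputable def expMechanism (u : Ω → ℝ) : PMF Ω :=
  PMF.normalize (expWeight u) (tsum_expWeight_ne_zero u) (tsum_expWeight_ne_top u)

theorem expMechanism_toOuterMeasure_le {u u' : Ω → ℝ} {δ : ℝ} (h : ∀ ω, |u ω - u' ω| ≤ δ)
    (E : Set Ω) :
    (expMechanism u).toOuterMeasure E ≤
      ENNReal.ofReal (Real.exp (2 * δ)) * (expMechanism u').toOuterMeasure E := by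
  have h1 : ∀ ω, u' ω ≤ u ω + δ := fun ω => by linarith [(abs_le.1 (h ω)).1]
  have h2 : ∀ ω, u ω ≤ u' ω + δ := fun ω => by linarith [(abs_le.1 (h ω)).2]
  have hZ : (∑' ω, expWeight u ω)⁻¹ ≤
      ENNReal.ofReal (Real.exp δ) * (∑' ω, expWeight u' ω)⁻¹ := by
    have hle : ∑' ω, expWeight u' ω ≤ ENNReal.ofReal (Real.exp δ) * ∑' ω, expWeight u ω := by
      rw [← ENNReal.tsum_mul_left]
      exact ENNReal.tsum_le_tsum (expWeight_le h2)
    have he : ENNReal.ofReal (Real.exp δ) ≠ 0 := by simp [Real.exp_pos]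
    rw [← div_eq_mul_inv, ENNReal.le_div_iff_mul_le (Or.inl (tsum_expWeight_ne_zero _))
        (Or.inl (tsum_expWeight_ne_top _))]
    calc (∑' ω, expWeight u ω)⁻¹ * ∑' ω, expWeight u' ω
        ≤ (∑' ω, expWeight u ω)⁻¹ *
            (ENNReal.ofReal (Real.exp δ) * ∑' ω, expWeight u ω) := by gcongr
      _ = ENNReal.ofReal (Real.exp δ) * ((∑' ω, expWeight u ω)⁻¹ * ∑' ω, expWeight u ω) := by ring
      _ = _ := by
        rw [ENNReal.inv_mul_cancel (tsum_expWeight_ne_zero _) (tsum_expWeight_ne_top _), mul_one]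
  rw [PMF.toOuterMeasure_apply, PMF.toOuterMeasure_apply, ← ENNReal.tsum_mul_left]
  refine ENNReal.tsum_le_tsum fun ω => ?_
  by_cases hω : ω ∈ E
  · simp only [Set.indicator_of_mem hω, expMechanism, PMF.normalize_apply]
    calc expWeight u ω * (∑' ω, expWeight u ω)⁻¹
        ≤ (ENNReal.ofReal (Real.exp δ) * expWeight u' ω) *
            (ENNReal.ofReal (Real.exp δ) * (∑' ω, expWeight u' ω)⁻¹) :=
          mul_le_mul' (expWeight_le h1 ω) hZ
      _ = _ := by
        rw [two_mul, Real.exp_add, ENNReal.ofReal_mul (Real.exp_nonneg _)]; ring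
  · simp [Set.indicator_of_notMem hω]

end Mechanism

section Product

variable {ι K : Type*} [Fintype ι] [DecidableEq ι] [Fintype K] [Nonempty K]

/-- Resampling argument: replacing the `j`-th coordinate by the lossless `κ` multiplies the weight
by at least `exp b`, and at most `|K|` outcomes are mapped to the same one. -/
theorem expMechanism_coordinate_le (v : ι → K → ℝ) (j : ι) (κ : K) (hκ : v j κ = 0) (b : ℝ) :
    (expMechanism fun c : ι → K => ∑ i, v i (c i)).toOuterMeasure {c | b ≤ v j (c j)} ≤
      Fintype.card K * ENNReal.ofReal (Real.exp (-b)) := by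
  set u : (ι → K) → ℝ := fun c => ∑ i, v i (c i) with hu
  have hupd : ∀ c, u c = u (Function.update c j κ) + v j (c j) := fun c => by
    simp only [hu]
    rw [← Finset.add_sum_erase _ _ (Finset.mem_univ j),
      ← Finset.add_sum_erase _ (fun i => v i (Function.update c j κ i)) (Finset.mem_univ j)]
    have herase : ∑ i ∈ Finset.univ.erase j, v i (Function.update c j κ i) =
        ∑ i ∈ Finset.univ.erase j, v i (c i) := Finset.sum_congr rfl fun i hi => by
      rw [Function.update_of_ne (Finset.ne_of_mem_erase hi)]
    rw [herase, Function.update_self, hκ]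
    ring
  have hinj : Function.Injective fun c : ι → K => (c j, Function.update c j κ) := by
    intro c c' h
    simp only [Prod.mk.injEq] at h
    funext i
    by_cases hi : i = j
    · rw [hi, h.1]
    · simpa [Function.update_of_ne hi] using congrFun h.2 i
  have hsum : ∑' c, Set.indicator {c | b ≤ v j (c j)} (expWeight u) c ≤
      ENNReal.ofReal (Real.exp (-b)) * (Fintype.card K * ∑' c, expWeight u c) := by
    calc ∑' c, Set.indicator {c | b ≤ v j (c j)} (expWeight u) c
        ≤ ∑' c, ENNReal.ofReal (Real.exp (-b)) * expWeight u (Function.update c j κ) := by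
          refine ENNReal.tsum_le_tsum fun c => ?_
          by_cases hc : c ∈ {c : ι → K | b ≤ v j (c j)}
          · rw [Set.indicator_of_mem hc, expWeight, expWeight,
              ← ENNReal.ofReal_mul (Real.exp_nonneg _), ← Real.exp_add, hupd c]
            exact ENNReal.ofReal_le_ofReal (Real.exp_le_exp.2 (by linarith [hc.out]))
          · simp [Set.indicator_of_notMem hc]
      _ ≤ ENNReal.ofReal (Real.exp (-b)) * ∑' p : K × (ι → K), expWeight u p.2 := by
          rw [ENNReal.tsum_mul_left]
          gcongr
          exact ENNReal.tsum_comp_le_tsum_of_injective hinj fun p => expWeight u p.2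
      _ = _ := by
          rw [ENNReal.tsum_prod (f := fun _ c => expWeight u c)]
          simp
  rw [PMF.toOuterMeasure_apply]
  have hnorm : ∀ c, Set.indicator {c | b ≤ v j (c j)} (expMechanism u) c =
      Set.indicator {c | b ≤ v j (c j)} (expWeight u) c * (∑' c, expWeight u c)⁻¹ := fun c => by
    by_cases hc : c ∈ {c : ι → K | b ≤ v j (c j)}
    · simp only [Set.indicator_of_mem hc, expMechanism, PMF.normalize_apply]
    · simp only [Set.indicator_of_notMem hc, zero_mul]
  rw [tsum_congr hnorm, ENNReal.tsum_mul_right]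
  calc _ ≤ ENNReal.ofReal (Real.exp (-b)) * (Fintype.card K * ∑' c, expWeight u c) *
        (∑' c, expWeight u c)⁻¹ := by gcongr
    _ = Fintype.card K * ENNReal.ofReal (Real.exp (-b)) *
        ((∑' c, expWeight u c) * (∑' c, expWeight u c)⁻¹) := by ring
    _ = _ := by
        rw [ENNReal.mul_inv_cancel (tsum_expWeight_ne_zero _) (tsum_expWeight_ne_top _), mul_one]

/-- If every coordinate has a lossless value, the mechanism returns small losses in all coordinates
with high probability. -/
theorem le_expMechanism_forall_lt (v : ι → K → ℝ) (hv : ∀ j, ∃ κ, v j κ = 0) {b β : ℝ}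
    (hβ : 0 ≤ β) (hb : Fintype.card ι * (Fintype.card K * Real.exp (-b)) ≤ β) :
    ENNReal.ofReal (1 - β) ≤
      (expMechanism fun c : ι → K => ∑ i, v i (c i)).toOuterMeasure {c | ∀ j, v j (c j) < b} := by
  set p := expMechanism fun c : ι → K => ∑ i, v i (c i)
  set G : Set (ι → K) := {c | ∀ j, v j (c j) < b} with hG
  have hbad : p.toOuterMeasure (⋃ j, {c | b ≤ v j (c j)}) ≤ ENNReal.ofReal β := by
    calc p.toOuterMeasure (⋃ j, {c | b ≤ v j (c j)})
        ≤ ∑' j, p.toOuterMeasure {c | b ≤ v j (c j)} := MeasureTheory.measure_iUnion_le _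
      _ ≤ ∑' _ : ι, (Fintype.card K * ENNReal.ofReal (Real.exp (-b))) := by
          refine ENNReal.tsum_le_tsum fun j => ?_
          obtain ⟨κ, hκ⟩ := hv j
          exact expMechanism_coordinate_le v j κ hκ b
      _ = ENNReal.ofReal (Fintype.card ι * (Fintype.card K * Real.exp (-b))) := by
          rw [ENNReal.ofReal_mul (by positivity), ENNReal.ofReal_mul (by positivity)]
          simp
      _ ≤ ENNReal.ofReal β := ENNReal.ofReal_le_ofReal hb
  have hone : (1 : ℝ≥0∞) ≤ p.toOuterMeasure G + ENNReal.ofReal β := by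
    calc (1 : ℝ≥0∞) = p.toOuterMeasure Set.univ :=
          ((p.toOuterMeasure_apply_eq_one_iff _).2 (Set.subset_univ _)).symm
      _ ≤ p.toOuterMeasure (G ∪ ⋃ j, {c | b ≤ v j (c j)}) := by
          refine MeasureTheory.measure_mono fun c _ => ?_
          by_cases hc : c ∈ G
          · exact Or.inl hc
          · refine Or.inr ?_
            simpa [hG] using hc
      _ ≤ p.toOuterMeasure G + p.toOuterMeasure (⋃ j, {c | b ≤ v j (c j)}) :=
          MeasureTheory.measure_union_le _ _
      _ ≤ _ := by gcongr
  rw [ENNReal.ofReal_sub _ hβ, ENNReal.ofReal_one]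
  exact tsub_le_iff_right.2 hone

end Product

/-! ### Mismatches between infinite words and primitive periods -/

section Words

variable {α : Type*}

/-- The infinite repetition `Q^∞` of a nonempty string. -/
def infRepeat {q : ℕ} (Q : Fin q → α) (hq : 0 < q) : ℕ → α := fun x => Q ⟨x % q, Nat.mod_lt _ hq⟩

theorem infRepeat_periodic {q : ℕ} (Q : Fin q → α) (hq : 0 < q) :
    Function.Periodic (infRepeat Q hq) q := fun x => by
  simp [infRepeat]

/-- The infinite repetition of a primitive `Q` has no period that is not a multiple of `|Q|`. -/
theorem IsPrimitive.dvd_of_periodic {q : ℕ} {Q : Fin q → α} (hQ : IsPrimitive Q) {s : ℕ}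
    (hs : Function.Periodic (infRepeat Q hQ.pos) s) : q ∣ s := by
  by_contra hdvd
  have hq := hQ.pos
  set g := Nat.gcd s q
  have hgpos : 0 < g := Nat.gcd_pos_of_pos_right _ hq
  have hgq : g ∣ q := Nat.gcd_dvd_right _ _
  have hlt : g < q := lt_of_le_of_ne (Nat.le_of_dvd hq hgq) fun h =>
    hdvd (h ▸ Nat.gcd_dvd_left s q)
  -- A multiple of `s` is congruent to the greatest common divisor modulo `q`.
  have hg : Function.Periodic (infRepeat Q hq) g := by
    obtain ⟨c, -, hc⟩ := Nat.exists_mul_mod_eq_gcd hlt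
    intro x
    have h1 : infRepeat Q hq (x + s * c) = infRepeat Q hq x := by
      rw [mul_comm]; simpa using hs.nat_mul c x
    rw [← h1]
    unfold infRepeat
    congr 2
    rw [Nat.add_mod x (s * c), hc, Nat.add_mod x g, Nat.mod_eq_of_lt hlt]
  obtain ⟨r, hr⟩ := hgq
  have hr2 : 2 ≤ r := by
    by_contra h
    have : r = 0 ∨ r = 1 := by omega
    rcases this with rfl | rfl <;> omega
  refine hQ ⟨r, g, hr2, by rw [hr, mul_comm], fun x => Q ⟨x, x.2.trans hlt⟩, ?_⟩
  funext x
  have h2 : infRepeat Q hq (x : ℕ) = infRepeat Q hq (x % g) := (hg.map_mod_nat x).symm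
  simp only [infRepeat, Nat.mod_eq_of_lt x.2,
    Nat.mod_eq_of_lt ((Nat.mod_lt (x : ℕ) hgpos).trans hlt)] at h2
  simpa [Fin.repeat, Fin.modNat] using h2

variable [DecidableEq α]

/-- The number of mismatches between the prefixes of length `m` of two infinite words. -/
def prefixDist (f g : ℕ → α) (m : ℕ) : ℕ := Finset.card {x ∈ Finset.range m | f x ≠ g x}

theorem prefixDist_comm (f g : ℕ → α) (m : ℕ) : prefixDist f g m = prefixDist g f m := by
  simp only [prefixDist, ne_comm]

theorem prefixDist_triangle (f g h : ℕ → α) (m : ℕ) :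
    prefixDist f h m ≤ prefixDist f g m + prefixDist g h m := by
  classical
  refine (Finset.card_le_card (t := {x ∈ Finset.range m | f x ≠ g x} ∪
    {x ∈ Finset.range m | g x ≠ h x}) fun x => ?_).trans (Finset.card_union_le _ _)
  simp only [Finset.mem_union, Finset.mem_filter]
  grind

theorem prefixDist_mono (f g : ℕ → α) {m m' : ℕ} (h : m ≤ m') :
    prefixDist f g m ≤ prefixDist f g m' :=
  Finset.card_le_card (Finset.filter_subset_filter _ (Finset.range_mono h))

theorem prefixDist_shift_le (f g : ℕ → α) (s : ℕ) {m l : ℕ} (h : s + l ≤ m) :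
    prefixDist (fun x => f (s + x)) (fun x => g (s + x)) l ≤ prefixDist f g m := by
  refine Finset.card_le_card_of_injOn (s + ·) (fun x hx => ?_) (fun x _ y _ h => by simpa using h)
  simp only [Finset.coe_filter, Finset.mem_range, Set.mem_ofPred_eq] at hx ⊢
  exact ⟨by omega, hx.2⟩

theorem hammingDist_eq_prefixDist {m : ℕ} (f g : Fin m → α) (F G : ℕ → α)
    (hF : ∀ x : Fin m, F x = f x) (hG : ∀ x : Fin m, G x = g x) :
    hammingDist f g = prefixDist F G m := by
  refine Finset.card_bij (fun x _ => (x : ℕ)) (fun x hx => ?_) (fun x _ y _ h => Fin.ext h)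
    fun x hx => ?_
  · simpa [hF, hG] using hx
  · simp only [Finset.mem_filter, Finset.mem_range] at hx
    exact ⟨⟨x, hx.1⟩, by simpa [← hF, ← hG] using hx.2, rfl⟩

/-- A shift of `Q^∞` by a non-multiple of `|Q|` creates a mismatch in every window of length `|Q|`,
if `Q` is primitive. -/
theorem IsPrimitive.div_le_prefixDist {q : ℕ} {Q : Fin q → α} (hQ : IsPrimitive Q) {s : ℕ}
    (hs : ¬ q ∣ s) (l : ℕ) :
    l / q ≤ prefixDist (fun x => infRepeat Q hQ.pos (s + x)) (infRepeat Q hQ.pos) l := by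
  have hq := hQ.pos
  set w := infRepeat Q hq
  have hw : Function.Periodic w q := infRepeat_periodic Q hq
  have hx : ∃ x < q, w (s + x) ≠ w x := by
    by_contra! h
    refine hs (hQ.dvd_of_periodic fun x => ?_)
    have h1 := h (x % q) (Nat.mod_lt _ hq)
    rw [hw.map_mod_nat] at h1
    change w (x + s) = w x
    rw [← h1, add_comm, ← hw.map_mod_nat (s + x), ← hw.map_mod_nat (s + x % q), Nat.add_mod_mod]
  obtain ⟨x, hxq, hx⟩ := hx
  rw [← Finset.card_range (l / q)]
  refine Finset.card_le_card_of_injOn (fun c => x + c * q) (fun c hc => ?_) fun c _ c' _ h => ?_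
  · simp only [Finset.coe_range, Set.mem_Iio] at hc
    have h1 : (c + 1) * q ≤ l := (Nat.mul_le_mul_right q hc).trans (Nat.div_mul_le_self l q)
    have h2 : ∀ y, w (y + c * q) = w y := fun y => by simpa using hw.nat_mul c y
    simp only [Finset.coe_filter, Finset.mem_range, Set.mem_ofPred_eq]
    refine ⟨by rw [add_mul] at h1; omega, ?_⟩
    rw [← add_assoc, h2, h2]
    exact hx
  · simpa [hq.ne'] using h

/-- Two alignments of `w` with the text at distance `s` induce an alignment of `w` with its own
shift by `s` on their overlap. -/
theorem prefixDist_self_shift_le (w S : ℕ → α) (i s m : ℕ) :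
    prefixDist (fun x => w (s + x)) w (m - s) ≤
      prefixDist w (fun x => S (i + x)) m + prefixDist w (fun x => S (i + s + x)) m := by
  rcases Nat.lt_or_ge m s with h | h
  · simp [prefixDist, Nat.sub_eq_zero_of_le h.le]
  refine (prefixDist_triangle _ (fun x => S (i + s + x)) _ _).trans (add_le_add ?_ ?_)
  · have := prefixDist_shift_le w (fun x => S (i + x)) s (m := m) (l := m - s) (by omega)
    simpa [add_assoc] using this
  · rw [prefixDist_comm]
    exact prefixDist_mono _ _ (Nat.sub_le _ _)

/-- An alignment between two overlapping alignments that differ by multiples of the period has at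
most the mismatches of the two outer ones. -/
theorem prefixDist_between_le {w S : ℕ → α} {q l i r m : ℕ} (hw : Function.Periodic w q)
    (hli : l ≤ i) (hir : i ≤ r) (hrl : r ≤ l + m) (h1 : q ∣ i - l) (h2 : q ∣ r - i) :
    prefixDist w (fun x => S (i + x)) m ≤
      prefixDist w (fun x => S (l + x)) m + prefixDist w (fun x => S (r + x)) m := by
  classical
  obtain ⟨a, ha⟩ := h1
  obtain ⟨b, hb⟩ := h2
  have hwm : ∀ c y, w (y + q * c) = w y := fun c y => by
    rw [mul_comm]; simpa using hw.nat_mul c y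
  have hsub : {x ∈ Finset.range m | w x ≠ S (i + x)} ⊆
      ({x ∈ Finset.range m | w x ≠ S (l + x)}.image (· - (i - l))) ∪
      ({x ∈ Finset.range m | w x ≠ S (r + x)}.image (· + (r - i))) := by
    intro x hx
    simp only [Finset.mem_filter, Finset.mem_range, Finset.mem_union, Finset.mem_image] at hx ⊢
    -- The text position `i + x` lies in the window at `l`, or else in the window at `r`.
    by_cases hlt : x + (i - l) < m
    · refine Or.inl ⟨x + (i - l), ⟨hlt, ?_⟩, by omega⟩
      have : l + (x + (i - l)) = i + x := by omega
      rw [this, ha, hwm]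
      exact hx.2
    · refine Or.inr ⟨x - (r - i), ⟨by omega, ?_⟩, by omega⟩
      have h3 : r + (x - (r - i)) = i + x := by omega
      have h4 : w (x - (r - i)) = w x := by
        rw [← hwm b, ← hb]
        congr 1
        omega
      rw [h3, h4]
      exact hx.2
  refine (Finset.card_le_card hsub).trans ((Finset.card_union_le _ _).trans
    (add_le_add Finset.card_image_le Finset.card_image_le))

/-- A prefix of length `m` with period `s` is a prefix of the repetition of a primitive word of length
at most `s`, namely of its own prefix whose length is its smallest period. -/
theorem exists_primitive_prefix (P : ℕ → α) {m s : ℕ} (hs : 0 < s)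
    (hP : ∀ x, x + s < m → P (x + s) = P x) :
    ∃ (q : ℕ) (Q : Fin q → α) (hQ : IsPrimitive Q), q ≤ s ∧
      prefixDist P (infRepeat Q hQ.pos) m = 0 := by
  classical
  have hex : ∃ q, 0 < q ∧ ∀ x, x + q < m → P (x + q) = P x := ⟨s, hs, hP⟩
  set q := Nat.find hex
  obtain ⟨hq, hqP⟩ := Nat.find_spec hex
  have hmod : ∀ x < m, P x = P (x % q) := by
    intro x
    induction x using Nat.strong_induction_on with
    | _ x ih =>
      intro hx
      rcases Nat.lt_or_ge x q with h | h
      · rw [Nat.mod_eq_of_lt h]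
      · have h1 := hqP (x - q) (by omega)
        have h2 := ih (x - q) (by omega) (by omega)
        rw [Nat.sub_add_cancel h] at h1
        rw [h1, h2, ← Nat.mod_eq_sub_mod h]
  have hprim : IsPrimitive fun x : Fin q => P x := by
    rintro ⟨r, t, hr, hqt, T, hT⟩
    have ht : 0 < t := Nat.pos_of_ne_zero fun h => by subst h; omega
    have hTx : ∀ x, x < q → P x = T ⟨x % t, Nat.mod_lt _ ht⟩ := fun x hx => by
      simpa [Fin.repeat, Fin.modNat] using congrFun hT ⟨x, hx⟩
    have htq : t ∣ q := ⟨r, by rw [hqt, mul_comm]⟩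
    have hlt : t < q := by nlinarith
    refine Nat.find_min hex hlt ⟨ht, fun x hx => ?_⟩
    rw [hmod _ hx, hmod x (by omega), hTx _ (Nat.mod_lt _ hq), hTx _ (Nat.mod_lt _ hq)]
    congr 2
    rw [Nat.mod_mod_of_dvd _ htq, Nat.mod_mod_of_dvd _ htq, Nat.add_mod_right]
  refine ⟨q, _, hprim, Nat.find_min' hex ⟨hs, hP⟩, ?_⟩
  rw [prefixDist, Finset.card_eq_zero, Finset.filter_eq_empty_iff]
  intro x hx
  simpa [infRepeat] using hmod x (Finset.mem_range.1 hx)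

end Words

/-! ### Near occurrences inside a short block of starting positions -/

section NearOccurrences

variable {α : Type*} [DecidableEq α]

/-- Two near occurrences of an almost periodic pattern with a large overlap start at positions that
are congruent modulo the period: otherwise the overlap would contain too many mismatches. -/
theorem IsPrimitive.dvd_sub_of_near {P S : ℕ → α} {m k t i j q : ℕ} {Q : Fin q → α}
    (hQ : IsPrimitive Q) (hP : prefixDist P (infRepeat Q hQ.pos) m ≤ 2 * k)
    (hqm : q * (2 * (2 * (2 * k + t) + 1)) ≤ m) (hij : i ≤ j) (hm : 2 * (j - i) < m)
    (hi : prefixDist P (fun x => S (i + x)) m ≤ t)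
    (hj : prefixDist P (fun x => S (j + x)) m ≤ t) : q ∣ j - i := by
  by_contra hdvd
  have h1 := hQ.div_le_prefixDist hdvd (m - (j - i))
  have h2 := prefixDist_self_shift_le (infRepeat Q hQ.pos) S i (j - i) m
  rw [Nat.add_sub_cancel' hij] at h2
  rw [prefixDist_comm] at hP
  have h3 := prefixDist_triangle (infRepeat Q hQ.pos) P (fun x => S (i + x)) m
  have h4 := prefixDist_triangle (infRepeat Q hQ.pos) P (fun x => S (j + x)) m
  have h5 : 2 * (2 * k + t) + 1 ≤ (m - (j - i)) / q := by
    rw [Nat.le_div_iff_mul_le hQ.pos, mul_comm]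
    have : q * (2 * (2 * (2 * k + t) + 1)) = 2 * (q * (2 * (2 * k + t) + 1)) := by ring
    omega
  omega

/-- The near occurrences in a short block lie on an arithmetic progression, all of whose members are
occurrences with few mismatches. Without any assumption on the pattern this holds for exact
occurrences, since two of them force a period on the pattern. -/
theorem exists_progression_of_near {P S : ℕ → α} {m n k t : ℕ} (hmn : m ≤ n)
    {F : Finset ℕ} (hFn : ∀ i ∈ F, i < n) (hF : ∀ i ∈ F, prefixDist P (fun x => S (i + x)) m ≤ t)
    (hdiam : ∀ i ∈ F, ∀ j ∈ F, 2 * (j - i) < m)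
    (hper : (k = 0 ∧ t = 0) ∨ ∃ (q : ℕ) (Q : Fin q → α) (hQ : IsPrimitive Q),
      prefixDist P (infRepeat Q hQ.pos) m ≤ 2 * k ∧ q * (2 * (2 * (2 * k + t) + 1)) ≤ m) :
    ∃ l r q : ℕ, l ≤ n ∧ r ≤ n ∧ q ≤ n ∧ (∀ i ∈ F, l ≤ i ∧ i < r ∧ q ∣ i - l) ∧
      ∀ i, l ≤ i → i < r → q ∣ i - l → prefixDist P (fun x => S (i + x)) m ≤ 6 * k + 2 * t := by
  rcases F.eq_empty_or_nonempty with rfl | hne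
  · exact ⟨0, 0, 0, by omega, by omega, by omega, by simp, by omega⟩
  -- The progression runs from the first to the last near occurrence.
  set l := F.min' hne
  set r := F.max' hne
  have hl : l ∈ F := F.min'_mem hne
  have hr : r ∈ F := F.max'_mem hne
  have hlF : ∀ i ∈ F, l ≤ i := fun i hi => F.min'_le i hi
  have hrF : ∀ i ∈ F, i ≤ r := fun i hi => F.le_max' i hi
  have hln := hFn l hl
  have hrn := hFn r hr
  rcases (hlF r hr).eq_or_lt with hlr | hlr
  · refine ⟨l, r + 1, 0, by omega, by omega, by omega, fun i hi => ?_, fun i h1 h2 _ => ?_⟩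
    · have := hlF i hi
      have := hrF i hi
      exact ⟨by omega, by omega, by simp; omega⟩
    · obtain rfl : i = l := by omega
      have := hF _ hl
      omega
  obtain ⟨q, Q, hQ, hPQ, hqm⟩ : ∃ (q : ℕ) (Q : Fin q → α) (hQ : IsPrimitive Q),
      prefixDist P (infRepeat Q hQ.pos) m ≤ 2 * k ∧ q * (2 * (2 * (2 * k + t) + 1)) ≤ m := by
    rcases hper with ⟨rfl, rfl⟩ | h
    · have hdist := hdiam l hl r hr
      have heq : ∀ i ∈ F, ∀ x < m, P x = S (i + x) := fun i hi x hx => by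
        have h0 := Nat.le_zero.1 (hF i hi)
        rw [prefixDist, Finset.card_eq_zero, Finset.filter_eq_empty_iff] at h0
        simpa using h0 (Finset.mem_range.2 hx)
      obtain ⟨q, Q, hQ, hqs, h0⟩ := exists_primitive_prefix P (m := m) (s := r - l) (by omega)
        fun x hx => by
          rw [heq l hl _ hx, heq r hr x (by omega)]
          congr 1
          omega
      exact ⟨q, Q, hQ, by omega, by omega⟩
    · exact h
  have hq : q ≤ m := le_trans (Nat.le_mul_of_pos_right q (by omega)) hqm
  have hdvd : ∀ i ∈ F, ∀ j ∈ F, i ≤ j → q ∣ j - i := fun i hi j hj hij =>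
    hQ.dvd_sub_of_near hPQ hqm hij (hdiam i hi j hj) (hF i hi) (hF j hj)
  refine ⟨l, r + 1, q, by omega, by omega, by omega, fun i hi => ?_, fun i h1 h2 h3 => ?_⟩
  · have := hrF i hi
    exact ⟨hlF i hi, by omega, hdvd l hl i hi (hlF i hi)⟩
  · have hdist := hdiam l hl r hr
    have h4 : q ∣ r - i := by
      have h5 := Nat.dvd_sub (hdvd l hl r hr hlr.le) h3
      rwa [show r - l - (i - l) = r - i by omega] at h5
    have h5 := prefixDist_between_le (S := S) (m := m) (infRepeat_periodic Q hQ.pos) h1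
      (by omega : i ≤ r) (by omega) h3 h4
    have h6 := prefixDist_triangle (infRepeat Q hQ.pos) P (fun x => S (l + x)) m
    have h7 := prefixDist_triangle (infRepeat Q hQ.pos) P (fun x => S (r + x)) m
    have h8 := prefixDist_triangle P (infRepeat Q hQ.pos) (fun x => S (i + x)) m
    have h9 := hF l hl
    have h10 := hF r hr
    rw [prefixDist_comm] at h6 h7
    rw [prefixDist_comm (infRepeat Q hQ.pos) P] at h6 h7
    rw [prefixDist_comm _ (infRepeat Q hQ.pos)] at h6 h7
    omega

end NearOccurrences

/-! ### The reporting algorithm -/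

section Algorithm

variable {α : Type*} [DecidableEq α] {m n : ℕ}

/-- Parameters `(l, r, q)` of the arithmetic progression of all `i ∈ [l, r)` with `i ≡ l` modulo
`q`. -/
abbrev Progression (n : ℕ) := Fin (n + 1) × Fin (n + 1) × Fin (n + 1)

/-- Membership in the arithmetic progression with parameters `κ`; for `q = 0` it is at most a
singleton, for `r ≤ l` it is empty. -/
abbrev Progression.Mem (κ : Progression n) (i : ℕ) : Prop :=
  (κ.1 : ℕ) ≤ i ∧ i < (κ.2.1 : ℕ) ∧ (κ.2.2 : ℕ) ∣ i - κ.1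

/-- The Hamming distance between the pattern and the window of the text starting at `i`. -/
def windowDist (P : Fin m → α) (S : Fin n → α) (i : Fin (n + 1 - m)) : ℕ :=
  hammingDist P (substr S m i (by omega))

/-- The length of a block of consecutive starting positions, half the length of the pattern
rounded up, so that two positions in a block differ by less than `m / 2`. -/
def blockLength (m : ℕ) : ℕ := (m + 1) / 2

/-- How badly the progression `κ` reports the starting positions of the `j`-th block: the largest
amount by which an omitted window has distance below `T`, or a reported one distance above `T'`. -/
noncomputable def blockLoss (T T' : ℝ) (P : Fin m → α) (S : Fin n → α) (j : ℕ)
    (κ : Progression n) : ℝ≥0 :=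
  (Finset.univ.filter fun i : Fin (n + 1 - m) => (i : ℕ) / blockLength m = j).sup fun i =>
    Real.toNNReal (if κ.Mem i then windowDist P S i - T' else T - windowDist P S i)

/-- The loss of a choice of one progression for each block. There are at most `n` nonempty
blocks. -/
noncomputable def totalLoss (ε T T' : ℝ) (P : Fin m → α) (S : Fin n → α)
    (c : Fin n → Progression n) : ℝ :=
  ∑ j : Fin n, ε / 6 * blockLoss T T' P S j (c j)

/-- The set of starting positions described by a choice of one progression for each block. -/
def report (m : ℕ) (c : Fin n → Progression n) : Finset (Fin n) :=
  {i | (i : ℕ) + m ≤ n ∧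
    (c ⟨i / blockLength m, (Nat.div_le_self _ _).trans_lt i.2⟩).Mem i}

/-- The exponential mechanism that chooses one progression for each block and reports the chosen
positions. The thresholds may depend on the length of the text. -/
noncomputable def progressionReporter (α : Type*) [DecidableEq α] (m : ℕ) (ε : ℝ) (T T' : ℕ → ℝ) :
    ReportingAlgorithm α m :=
  fun n S P => (expMechanism (totalLoss ε (T n) (T' n) P S)).map (report m)

theorem windowDist_le_of_neighbouring (P : Fin m → α) {S S' : Fin n → α} (h : Neighbouring S S')
    (i : Fin (n + 1 - m)) : windowDist P S i ≤ windowDist P S' i + 1 := by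
  have h1 : hammingDist (substr S m i (by omega)) (substr S' m i (by omega)) ≤ 1 := by
    refine le_trans ?_ (show hammingDist S S' ≤ 1 from h.le)
    refine Finset.card_le_card_of_injOn (fun y => ⟨i + y, by omega⟩) (fun y hy => ?_)
      fun y _ z _ hyz => ?_
    · have hy := (Finset.mem_filter.1 hy).2
      simpa [substr] using hy
    · simpa [Fin.ext_iff] using hyz
  have h2 := hammingDist_triangle P (substr S' m i (by omega)) (substr S m i (by omega))
  rw [hammingDist_comm (substr S' m i _)] at h2
  unfold windowDist
  omega

theorem blockLoss_le_of_neighbouring (T T' : ℝ) (P : Fin m → α) {S S' : Fin n → α}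
    (h : Neighbouring S S') (j : ℕ) (κ : Progression n) :
    blockLoss T T' P S j κ ≤ blockLoss T T' P S' j κ + 1 := by
  refine Finset.sup_le fun i hi => ?_
  refine le_trans ?_ (add_le_add_left (Finset.le_sup hi) 1)
  have h1 : (windowDist P S i : ℝ) ≤ windowDist P S' i + 1 := by
    exact_mod_cast windowDist_le_of_neighbouring P h i
  have h2 : (windowDist P S' i : ℝ) ≤ windowDist P S i + 1 := by
    exact_mod_cast windowDist_le_of_neighbouring P ((hammingDist_comm _ _).trans h) i
  rw [Real.toNNReal_le_iff_le_coe]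
  push_cast
  split_ifs
  · linarith [Real.le_coe_toNNReal (windowDist P S' i - T')]
  · linarith [Real.le_coe_toNNReal (T - windowDist P S' i)]

/-- The loss of a block does not depend on letters outside all its windows. As the starting
positions of a block span about `m / 2` positions, each letter is seen by at most three blocks. -/
theorem blockLoss_congr (T T' : ℝ) (P : Fin m → α) {S S' : Fin n → α} {x : Fin n}
    (h : ∀ y, y ≠ x → S y = S' y) {j : ℕ}
    (hj : j ∉ Finset.Icc (x / blockLength m - 2) (x / blockLength m)) (κ : Progression n) :
    blockLoss T T' P S j κ = blockLoss T T' P S' j κ := by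
  refine Finset.sup_congr rfl fun i hi => ?_
  have hi : (i : ℕ) / blockLength m = j := by simpa using hi
  have hw : windowDist P S i = windowDist P S' i := by
    unfold windowDist
    congr 1
    funext y
    refine h _ fun hxy => hj ?_
    have hxy : (i : ℕ) + y = x := congrArg Fin.val hxy
    have hpos : 0 < blockLength m := by unfold blockLength; omega
    have h1 : (i : ℕ) / blockLength m ≤ x / blockLength m := Nat.div_le_div_right (by omega)
    have h2 : (x : ℕ) / blockLength m ≤ (i + 2 * blockLength m) / blockLength m :=
      Nat.div_le_div_right (by unfold blockLength; omega)
    rw [Nat.add_mul_div_right _ _ hpos] at h2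
    rw [Finset.mem_Icc]
    omega
  rw [hw]

theorem abs_totalLoss_sub_le {ε : ℝ} (hε : 0 ≤ ε) (T T' : ℝ) (P : Fin m → α) {S S' : Fin n → α}
    (h : Neighbouring S S') (c : Fin n → Progression n) :
    |totalLoss ε T T' P S c - totalLoss ε T T' P S' c| ≤ ε / 2 := by
  obtain ⟨x, hx⟩ := Finset.card_eq_one.1 h
  have hx : ∀ y, y ≠ x → S y = S' y := fun y hy => by
    by_contra hne
    exact hy (Finset.mem_singleton.1 (hx ▸ by simpa using hne))
  set J := Finset.Icc ((x : ℕ) / blockLength m - 2) (x / blockLength m) with hJ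
  have hterm : ∀ j : Fin n, |ε / 6 * blockLoss T T' P S j (c j) -
      ε / 6 * blockLoss T T' P S' j (c j)| ≤ if (j : ℕ) ∈ J then ε / 6 else 0 := fun j => by
    split_ifs with hj
    · have h1 : (blockLoss T T' P S j (c j) : ℝ) ≤ blockLoss T T' P S' j (c j) + 1 := by
        exact_mod_cast blockLoss_le_of_neighbouring T T' P h j (c j)
      have h2 : (blockLoss T T' P S' j (c j) : ℝ) ≤ blockLoss T T' P S j (c j) + 1 := by
        exact_mod_cast blockLoss_le_of_neighbouring T T' P ((hammingDist_comm _ _).trans h) j (c j)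
      rw [← mul_sub, abs_mul, abs_of_nonneg (by positivity)]
      exact mul_le_of_le_one_right (by positivity) (abs_le.2 ⟨by linarith, by linarith⟩)
    · rw [blockLoss_congr T T' P hx hj, sub_self, abs_zero]
  have hcard : ({j : Fin n | (j : ℕ) ∈ J} : Finset (Fin n)).card ≤ 3 := by
    calc _ ≤ J.card := Finset.card_le_card_of_injOn (fun j : Fin n => (j : ℕ))
          (fun j hj => by simpa using hj) fun i _ j _ hij => Fin.ext hij
      _ ≤ 3 := by rw [hJ, Nat.card_Icc]; omega
  calc _ ≤ ∑ j : Fin n, |ε / 6 * blockLoss T T' P S j (c j) -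
        ε / 6 * blockLoss T T' P S' j (c j)| := by
        rw [totalLoss, totalLoss, ← Finset.sum_sub_distrib]
        exact Finset.abs_sum_le_sum_abs _ _
    _ ≤ ∑ j : Fin n, if (j : ℕ) ∈ J then ε / 6 else 0 := Finset.sum_le_sum fun j _ => hterm j
    _ = ({j : Fin n | (j : ℕ) ∈ J} : Finset (Fin n)).card * (ε / 6) := by
        rw [← Finset.sum_filter, Finset.sum_const, nsmul_eq_mul]
    _ ≤ 3 * (ε / 6) := by gcongr; exact_mod_cast hcard
    _ = ε / 2 := by ring

theorem progressionReporter_isDifferentiallyPrivate {ε : ℝ} (hε : 0 ≤ ε) (T T' : ℕ → ℝ) :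
    IsDifferentiallyPrivate ε (progressionReporter α m ε T T') := by
  intro P n S S' h Out
  simp only [progressionReporter, PMF.toOuterMeasure_map_apply]
  have := expMechanism_toOuterMeasure_le (fun c => abs_totalLoss_sub_le hε (T n) (T' n) P h c)
    (report m ⁻¹' Out)
  rwa [mul_div_cancel₀ ε two_ne_zero] at this

/-- Block losses below `a` leave no omitted window at distance at most `T - a`, and no reported
window at distance `T' + a` or more. -/
theorem isReport_report {k : ℕ} {γ a T T' b : ℝ} (hT : T = k + a) (hT' : T' + a ≤ (1 + γ) * k + b)
    {P : Fin m → α} {S : Fin n → α} {c : Fin n → Progression n}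
    (hc : ∀ j : Fin n, (blockLoss T T' P S j (c j) : ℝ) < a) :
    IsReport S P k γ b (report m c) := by
  have hle : ∀ (i : Fin n) (hi : (i : ℕ) + m ≤ n),
      (if (c ⟨i / blockLength m, (Nat.div_le_self _ _).trans_lt i.2⟩).Mem i then
        (hammingDist P (substr S m i hi) : ℝ) - T' else T - hammingDist P (substr S m i hi)) < a :=
    fun i hi => by
      refine lt_of_le_of_lt ?_ (hc ⟨i / blockLength m, (Nat.div_le_self _ _).trans_lt i.2⟩)
      rw [← Real.toNNReal_le_iff_le_coe]
      exact Finset.le_sup (f := fun i : Fin (n + 1 - m) => Real.toNNReal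
        (if (c _).Mem i then windowDist P S i - T' else T - windowDist P S i))
        (b := ⟨i, by omega⟩) (by simp)
  refine ⟨fun i hi => ?_, fun i hi hd => ?_, fun i hi hmem => ?_⟩
  · simp only [report, Finset.mem_filter] at hi
    exact hi.2.1
  · by_contra hmem
    have h1 := hle i hi
    rw [if_neg fun h => hmem (Finset.mem_filter.2 ⟨Finset.mem_univ _, hi, h⟩)] at h1
    have h2 : (hammingDist P (substr S m i hi) : ℝ) ≤ k := by exact_mod_cast hd
    linarith
  · have h1 := hle i hi
    rw [if_pos (Finset.mem_filter.1 hmem).2.2] at h1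
    linarith

/-- Under the periodicity hypothesis every block has a progression without loss. -/
theorem exists_blockLoss_eq_zero {k t : ℕ} {T T' : ℝ} (hT : T < t + 1) (hT' : 6 * k + 2 * t ≤ T')
    (hm : 0 < m) (hmn : m ≤ n) (P : Fin m → α) (S : Fin n → α)
    (hper : (k = 0 ∧ t = 0) ∨ ∃ (q : ℕ) (Q : Fin q → α) (hQ : IsPrimitive Q),
      hammingDist P (repeatPrefix Q hQ.pos m) ≤ 2 * k ∧
        q * (2 * (2 * (2 * k + t) + 1)) ≤ m) (j : ℕ) :
    ∃ κ, blockLoss T T' P S j κ = 0 := by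
  -- Letters beyond the ends of the two strings play no role.
  obtain ⟨P', hP'⟩ : ∃ P' : ℕ → α, ∀ x : Fin m, P' x = P x :=
    ⟨fun x => if h : x < m then P ⟨x, h⟩ else P ⟨0, hm⟩, fun x => by simp⟩
  obtain ⟨S', hS'⟩ : ∃ S' : ℕ → α, ∀ x : Fin n, S' x = S x :=
    ⟨fun x => if h : x < n then S ⟨x, h⟩ else S ⟨0, by omega⟩, fun x => by simp⟩
  have hd : ∀ i : Fin (n + 1 - m), windowDist P S i = prefixDist P' (fun x => S' (i + x)) m :=
    fun i => hammingDist_eq_prefixDist _ _ _ _ hP' fun x => hS' ⟨i + x, by omega⟩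
  set F : Finset ℕ := {i ∈ Finset.range (n + 1 - m) | i / blockLength m = j ∧
    prefixDist P' (fun x => S' (i + x)) m ≤ t} with hF
  have hpos : 0 < blockLength m := by unfold blockLength; omega
  obtain ⟨l, r, q, hl, hr, hq, hmem, hdist⟩ := exists_progression_of_near (F := F) (k := k) hmn
    (P := P') (S := S') (t := t)
    (fun i hi => by simp only [hF, Finset.mem_filter, Finset.mem_range] at hi; omega)
    (fun i hi => by simp only [hF, Finset.mem_filter] at hi; exact hi.2.2)
    (fun i hi i' hi' => by
      simp only [hF, Finset.mem_filter] at hi hi'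
      have h1 := Nat.div_add_mod i (blockLength m)
      have h2 := Nat.div_add_mod i' (blockLength m)
      have h3 := Nat.mod_lt i' hpos
      rw [hi.2.1] at h1
      rw [hi'.2.1] at h2
      have h4 : 2 * blockLength m ≤ m + 1 := by unfold blockLength; omega
      omega)
    (hper.imp_right fun ⟨q, Q, hQ, h1, h2⟩ => ⟨q, Q, hQ, by
      rwa [← hammingDist_eq_prefixDist P (repeatPrefix Q hQ.pos m) P' _ hP' fun _ => rfl], h2⟩)
  refine ⟨(⟨l, by omega⟩, ⟨r, by omega⟩, ⟨q, by omega⟩), ?_⟩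
  rw [blockLoss, ← bot_eq_zero, Finset.sup_eq_bot_iff]
  intro i hi
  have hi : (i : ℕ) / blockLength m = j := by simpa using hi
  rw [bot_eq_zero, Real.toNNReal_eq_zero]
  split_ifs with h
  · have h1 := hdist i h.1 h.2.1 h.2.2
    rw [← hd] at h1
    have h2 : (windowDist P S i : ℝ) ≤ 6 * k + 2 * t := by exact_mod_cast h1
    linarith
  · have h1 : t < windowDist P S i := by
      by_contra! h1
      rw [hd] at h1
      exact h (hmem i (Finset.mem_filter.2 ⟨Finset.mem_range.2 i.2, hi, h1⟩))
    have h2 : (t : ℝ) + 1 ≤ windowDist P S i := by exact_mod_cast h1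
    linarith

theorem card_mul_exp_neg_le {n : ℕ} (hn : 0 < n) {β : ℝ} (hβ0 : 0 < β) (hβ1 : β < 1) :
    (n : ℝ) * ((n + 1) ^ 3 * Real.exp (-(32 * (Real.log n + Real.log (6 / β))))) ≤ β := by
  have hn1 : (1 : ℝ) ≤ n := by exact_mod_cast hn
  have hβ : 6 < 6 / β := by rw [lt_div_iff₀ hβ0]; linarith
  rw [← Real.log_mul (by positivity) (by positivity)]
  set x := (n : ℝ) * (6 / β) with hx
  have hx6 : 6 * (n : ℝ) ≤ x := by rw [hx]; nlinarith
  have hx0 : 0 < x := by linarith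
  have hexp : Real.exp (-(32 * Real.log x)) ≤ (x ^ 5)⁻¹ := by
    rw [← Real.exp_log (by positivity : 0 < x ^ 5), ← Real.exp_neg, Real.log_pow]
    refine Real.exp_le_exp.2 ?_
    have := Real.log_nonneg (by linarith : 1 ≤ x)
    push_cast
    linarith
  calc (n : ℝ) * ((n + 1) ^ 3 * Real.exp (-(32 * Real.log x)))
      ≤ x * (x ^ 3 * (x ^ 5)⁻¹) := by gcongr <;> linarith
    _ = x⁻¹ := by field_simp
    _ ≤ β := by
      rw [inv_le_comm₀ hx0 hβ0]
      have : 6 / β = 6 * β⁻¹ := div_eq_mul_inv _ _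
      have : 0 < β⁻¹ := by positivity
      nlinarith

end Algorithm

end PatternMatching

open PatternMatching in
theorem mainTheorem2 {α : Type*} [DecidableEq α] (m k : ℕ) (ε β : ℝ)
    (hε : 0 < ε) (hβ0 : 0 < β) (hβ1 : β < 1) :
    ∃ A : PatternMatching.ReportingAlgorithm α m,
      PatternMatching.IsDifferentiallyPrivate ε A ∧
      ∀ (P : Fin m → α) (n : ℕ), m ≤ n →
        (∃ (q : ℕ) (Q : Fin q → α) (hQ : PatternMatching.IsPrimitive Q),
          (q : ℝ) ≤ (m : ℝ) / (32 * max (k : ℝ) (PatternMatching.errorTerm n ε β)) ∧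
          hammingDist P (PatternMatching.repeatPrefix Q hQ.pos m) ≤ 2 * k) →
        ∀ S : Fin n → α,
          (∀ I ∈ (A n S P).support, ∀ i ∈ I, (i : ℕ) + m ≤ n) ∧
          ENNReal.ofReal (1 - β) ≤ (A n S P).toOuterMeasure
            {I | PatternMatching.IsReport S P k 7 (6 * PatternMatching.errorTerm n ε β) I} := by
  refine ⟨progressionReporter α m ε (fun n => k + 2 * errorTerm n ε β)
    (fun n => 8 * k + 4 * errorTerm n ε β),
    progressionReporter_isDifferentiallyPrivate hε.le _ _, ?_⟩
  rintro P n hmn ⟨q, Q, hQ, hq, hPQ⟩ S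
  have hm : 0 < m := by
    refine Nat.pos_of_ne_zero fun h => ?_
    rw [h, Nat.cast_zero, zero_div] at hq
    exact hQ.pos.not_ge (by exact_mod_cast hq)
  have hn : 0 < n := by omega
  set e := errorTerm n ε β with he
  have he0 : 0 < e := by
    have h1 : 0 ≤ Real.log n := Real.log_natCast_nonneg n
    have h2 : 0 < Real.log (6 / β) := Real.log_pos (by rw [lt_div_iff₀ hβ0]; linarith)
    rw [he, errorTerm]
    positivity
  refine ⟨fun I hI i hi => ?_, ?_⟩
  · obtain ⟨c, -, rfl⟩ := (PMF.mem_support_map_iff _ _ _).1 hI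
    exact (Finset.mem_filter.1 hi).2.1
  set t := ⌊(k : ℝ) + 2 * e⌋₊ with ht
  have htle : (t : ℝ) ≤ k + 2 * e := Nat.floor_le (by positivity)
  have hper : (k = 0 ∧ t = 0) ∨ ∃ (q : ℕ) (Q : Fin q → α) (hQ : IsPrimitive Q),
      hammingDist P (repeatPrefix Q hQ.pos m) ≤ 2 * k ∧
        q * (2 * (2 * (2 * k + t) + 1)) ≤ m := by
    rcases lt_or_ge (max (k : ℝ) e) (1 / 6) with hC | hC
    · -- The bound on `|Q|` is void here, but the threshold only admits exact occurrences.
      obtain ⟨h1, h2⟩ := max_lt_iff.1 hC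
      have hk : k = 0 := by
        by_contra h
        have : (1 : ℝ) ≤ k := by exact_mod_cast Nat.one_le_iff_ne_zero.2 h
        linarith
      refine Or.inl ⟨hk, Nat.floor_eq_zero.2 ?_⟩
      linarith
    · -- With `C = max k e`, the needed factor is at most `12 k + 8 e + 2 ≤ 20 C + 12 C`.
      refine Or.inr ⟨q, Q, hQ, hPQ, ?_⟩
      rw [le_div_iff₀ (by positivity)] at hq
      have h1 := le_max_left (k : ℝ) e
      have h2 := le_max_right (k : ℝ) e
      have h3 : (q : ℝ) * (2 * (2 * (2 * k + t) + 1)) ≤ q * (32 * max (k : ℝ) e) := by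
        refine mul_le_mul_of_nonneg_left ?_ (Nat.cast_nonneg q)
        linarith
      exact_mod_cast h3.trans hq
  have hzero : ∀ j : Fin n, ∃ κ : Progression n,
      ε / 6 * (blockLoss (k + 2 * e) (8 * k + 4 * e) P S j κ : ℝ) = 0 := fun j => by
    obtain ⟨κ, hκ⟩ := exists_blockLoss_eq_zero (T := k + 2 * e) (T' := 8 * k + 4 * e)
      (Nat.lt_floor_add_one _) (by linarith) hm hmn P S hper j
    exact ⟨κ, by rw [hκ, NNReal.coe_zero, mul_zero]⟩
  have hprob := le_expMechanism_forall_lt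
    (fun (j : Fin n) κ => ε / 6 * (blockLoss (k + 2 * e) (8 * k + 4 * e) P S j κ : ℝ)) hzero
    (b := ε / 6 * (2 * e)) hβ0.le (by
      have h1 : ε / 6 * (2 * e) = 32 * (Real.log n + Real.log (6 / β)) := by
        rw [he, errorTerm]; field_simp; ring
      rw [h1]
      convert card_mul_exp_neg_le hn hβ0 hβ1 using 3
      · simp
      · simp; ring)
  refine hprob.trans ?_
  rw [progressionReporter, PMF.toOuterMeasure_map_apply]
  refine (expMechanism (totalLoss ε (k + 2 * e) (8 * k + 4 * e) P S)).toOuterMeasure.mono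
    fun c hc => ?_
  refine isReport_report (a := 2 * e) (T' := 8 * k + 4 * e) rfl (by linarith) fun j => ?_
  exact lt_of_mul_lt_mul_left (hc j : ε / 6 * _ < ε / 6 * (2 * e)) (by positivity)
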